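/- A \emph{voxel} is a cell of the three-dimensional unit cube grid; two voxels are adjacent if they share a face. A \emph{blob} is a non-empty finite set of voxels that is connected with respect to this adjacency. A \emph{voxel representation} of a graph $G$ assigns pairwise disjoint blobs to the vertices of $G$ such that, for any two distinct vertices $u$ and $v$, the blobs of $u$ and $v$ contain adjacent voxels if and only if $uv$ is an edge of $G$. Its \emph{size} is the total number of voxels in all blobs. \textbf{Theorem.} There is an absolute constant $C$ such that every finite simple graph $G$ with $n$ vertices and treewidth $\mathrm{tw}$ has a voxel representation of size at most $C\cdot n\cdot\max(\mathrm{tw},1)$. In particular, every $n$-vertex graph of treewidth $\mathrm{tw}\ge 1$ has a voxel representation of size $O(n\cdot \mathrm{tw})$. -/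

import Mathlib

/-- A tree decomposition of `G`: a finite tree `tree` with a bag of vertices of `G` at each of
its nodes.  (`SimpleGraph.Connected` includes non-emptiness, so every vertex is in some bag.) -/
structure TreeDecomposition {V : Type*} (G : SimpleGraph V) where
  Node : Type
  [fintypeNode : Fintype Node]
  tree : SimpleGraph Node
  isTree : tree.IsTree
  bag : Node → Finset V
  connected_nodes : ∀ v : V, (tree.induce {μ | v ∈ bag μ}).Connected
  exists_bag : ∀ u v : V, G.Adj u v → ∃ μ, u ∈ bag μ ∧ v ∈ bag μ

attribute [instance] TreeDecomposition.fintypeNode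

/-- The maximum bag size minus one.  (The subtraction truncates only if all bags are empty, that
is, only if the graph has no vertices.) -/
def TreeDecomposition.width {V : Type*} {G : SimpleGraph V} (D : TreeDecomposition G) : ℕ :=
  Finset.univ.sup (fun μ : D.Node => (D.bag μ).card) - 1

/-- The treewidth: the minimum width over all tree decompositions. -/
noncomputable def treewidth {V : Type*} (G : SimpleGraph V) : ℕ :=
  sInf {k : ℕ | ∃ D : TreeDecomposition G, D.width = k}

/-- Every finite graph has a tree decomposition: a single node whose bag is the vertex set. -/
def TreeDecomposition.trivial {V : Type*} [Fintype V] (G : SimpleGraph V) :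
    TreeDecomposition G where
  Node := Unit
  tree := ⊥
  isTree := SimpleGraph.IsTree.of_subsingleton
  bag := fun _ => Finset.univ
  connected_nodes := fun v => by
    have : Nonempty {μ : Unit | v ∈ (Finset.univ : Finset V)} := ⟨⟨(), by simp⟩⟩
    exact ⟨fun a b => by rw [Subsingleton.elim a b]⟩
  exists_bag := fun u v _ => ⟨(), by simp⟩

/-- The minimum in the definition of the treewidth of a finite graph is attained. -/
theorem exists_width_eq_treewidth {V : Type*} [Fintype V] (G : SimpleGraph V) :
    ∃ D : TreeDecomposition G, D.width = treewidth G :=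
  Nat.sInf_mem (s := {k : ℕ | ∃ D : TreeDecomposition G, D.width = k})
    ⟨_, TreeDecomposition.trivial G, rfl⟩

/-- A voxel, i.e. a cell of the unit cube grid, given by the integer coordinates of its centre. -/
abbrev Voxel : Type := ℤ × ℤ × ℤ

/-- Two voxels are adjacent if they share a face, i.e. if their centres differ by exactly one in
exactly one coordinate. -/
def voxelGrid : SimpleGraph Voxel where
  Adj p q := |p.1 - q.1| + |p.2.1 - q.2.1| + |p.2.2 - q.2.2| = 1
  symm := ⟨fun p q h => by
    rw [abs_sub_comm q.1, abs_sub_comm q.2.1, abs_sub_comm q.2.2]; exact h⟩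
  loopless := ⟨fun p h => by simp at h⟩

/-- A voxel representation of `G`: the vertices are represented by pairwise disjoint blobs
(non-empty finite connected sets of voxels), such that the blobs of two distinct vertices contain
adjacent voxels if and only if the two vertices are adjacent. -/
structure VoxelRepresentation {V : Type*} (G : SimpleGraph V) where
  blob : V → Finset Voxel
  connected_blob : ∀ v : V, (voxelGrid.induce (blob v : Set Voxel)).Connected
  disjoint_blob : ∀ u v : V, u ≠ v → Disjoint (blob u) (blob v)
  adj_iff : ∀ u v : V, u ≠ v →
    (G.Adj u v ↔ ∃ p ∈ blob u, ∃ q ∈ blob v, voxelGrid.Adj p q)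

/-- The size of a voxel representation: the total number of voxels it consists of. -/
def VoxelRepresentation.size {V : Type*} [Fintype V] {G : SimpleGraph V}
    (R : VoxelRepresentation G) : ℕ :=
  ∑ v : V, (R.blob v).card

/-! The space is used as a stack of planar drawings. Vertices are drawn as connected sets of cells
in a planar box; several vertices may share a cell if their colours differ, and a colour is a
height. With `O(tw)` colours and `O(n)` cells, thickening each cell to a block of constant base and
height `O(tw)` gives size `O(n * tw)`. Adjacent vertices share the home cell of one of them, where
the home vertex has a vertical column that an arm of the other reaches.

The drawing (`Layout`) is built by divide and conquer. Let `k` be the width. Two bags split a part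
`X` with boundary `B` into four: one balances `X`, the other balances `B`, so that boundaries stay
below `8 (k + 1)` and `10 (k + 1)` colours suffice (`exists_split`). The separator vertices get
homes in a small square, and a one-cell-thick bus, occupied by all of `B ∪ S`, runs from it below
the four children (`exists_compose`).

The children are drawn transposed. Putting four boxes side by side multiplies the scale `m ^ 0.9` by
at most 1.15, but the other side only has to fit the largest child, which gains a factor 0.773;
alternating the directions gives 1.15 * 0.773 < 1, so both sides remain `O(m ^ 0.9)`. As the
exponent is less than 1, the sum of the children's scales exceeds that of the parent by a constant
factor, up to the separator, and a negative term in the bound on the number of cells pays for the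
buses (`exists_layout`). -/

/-! ### Balanced separators from tree decompositions -/

/-- A finite family of weights, none more than half of `N`, with sum at most `N`, can be split into
two parts of weight at most `3N/4` each. -/
theorem exists_balanced_subset {γ : Type*} [DecidableEq γ] (s : Finset γ) (a : γ → ℕ) (N : ℕ)
    (ha : ∀ i ∈ s, 2 * a i ≤ N) (hs : ∑ i ∈ s, a i ≤ N) :
    ∃ t ⊆ s, 4 * ∑ i ∈ t, a i ≤ 3 * N ∧ 4 * ∑ i ∈ s \ t, a i ≤ 3 * N := by
  induction s using Finset.induction_on with
  | empty => exact ⟨∅, by simp⟩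
  | insert i s hi ih =>
    rw [Finset.sum_insert hi] at hs
    obtain ⟨t, hts, h1, h2⟩ := ih (fun j hj => ha j (Finset.mem_insert_of_mem hj)) (by omega)
    have hit : i ∉ t := fun h => hi (hts h)
    have hai := ha i (Finset.mem_insert_self i s)
    have hsum := Finset.sum_sdiff (f := a) hts
    -- The new weight `a i` joins the lighter part, which then weighs at most `(N - a i) / 2 + a i ≤
    -- 3 * N / 4`.
    rcases le_total (∑ i ∈ t, a i) (∑ i ∈ s \ t, a i) with h | h
    · refine ⟨insert i t, Finset.insert_subset_insert i hts, ?_, ?_⟩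
      · rw [Finset.sum_insert hit]; omega
      · have : insert i s \ insert i t = s \ t := by
          ext j
          simp only [Finset.mem_sdiff, Finset.mem_insert]
          grind
        rw [this]; exact h2
    · refine ⟨t, hts.trans (Finset.subset_insert i s), h1, ?_⟩
      rw [Finset.insert_sdiff_of_notMem s hit, Finset.sum_insert (by simp [hi])]
      omega

namespace SimpleGraph

variable {N : Type*} {T : SimpleGraph N}

/-- In a connected graph, each component of the complement of a node `μ` has a neighbour of
`μ`. -/
theorem Connected.exists_adj_mem_component (hT : T.Connected) (μ : N)
    (c : (T.induce ({μ}ᶜ : Set N)).ConnectedComponent) :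
    ∃ y : N, T.Adj μ y ∧
      ∃ h : y ∈ ({μ}ᶜ : Set N), (T.induce ({μ}ᶜ : Set N)).connectedComponentMk ⟨y, h⟩ = c := by
  classical
  induction c using ConnectedComponent.ind with
  | h x =>
  obtain ⟨x, hx⟩ := x
  obtain ⟨p, hp⟩ := (hT.preconnected μ x).exists_isPath
  cases p with
  | nil => exact absurd rfl hx
  | cons hadj q =>
    rename_i y
    rw [Walk.cons_isPath_iff] at hp
    refine ⟨y, hadj, fun h => hadj.ne h.symm, ?_⟩
    rw [ConnectedComponent.eq]
    have hq : ∀ z ∈ q.support, z ∈ ({μ}ᶜ : Set N) := fun z hz h => hp.2 (h ▸ hz)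
    exact ⟨q.induce _ hq⟩

/-- The two sides of an edge of an acyclic graph are disjoint. -/
theorem IsAcyclic.not_reachable_both (hT : T.IsAcyclic) {μ ν x : N} (hadj : T.Adj μ ν)
    (hν : ν ∈ ({μ}ᶜ : Set N)) (hμ : μ ∈ ({ν}ᶜ : Set N)) (hxμ : x ∈ ({μ}ᶜ : Set N))
    (hxν : x ∈ ({ν}ᶜ : Set N))
    (h1 : (T.induce ({μ}ᶜ : Set N)).Reachable ⟨x, hxμ⟩ ⟨ν, hν⟩)
    (h2 : (T.induce ({ν}ᶜ : Set N)).Reachable ⟨x, hxν⟩ ⟨μ, hμ⟩) : False := by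
  have hb := (isAcyclic_iff_forall_adj_isBridge.1 hT) hadj
  rw [isBridge_iff] at hb
  refine hb ?_
  -- A walk that avoids one end of the edge does not use the edge, so both ends could be reached
  -- from `x` without it, although it is a bridge.
  have e1 : (T.deleteEdges {s(μ, ν)}).Reachable x ν :=
    h1.map (f := (⟨Subtype.val, fun {a b} hab => by
      rw [deleteEdges_adj]
      refine ⟨hab, fun h => ?_⟩
      have ha := a.2
      have hb := b.2
      simp only [Set.mem_singleton_iff, Sym2.eq_iff, Set.mem_compl_iff] at h ha hb
      tauto⟩ : T.induce ({μ}ᶜ : Set N) →g T.deleteEdges {s(μ, ν)}))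
  have e2 : (T.deleteEdges {s(μ, ν)}).Reachable x μ :=
    h2.map (f := (⟨Subtype.val, fun {a b} hab => by
      rw [deleteEdges_adj]
      refine ⟨hab, fun h => ?_⟩
      have ha := a.2
      have hb := b.2
      simp only [Set.mem_singleton_iff, Sym2.eq_iff, Set.mem_compl_iff] at h ha hb
      tauto⟩ : T.induce ({ν}ᶜ : Set N) →g T.deleteEdges {s(μ, ν)}))
  exact e2.symm.trans e1

end SimpleGraph

namespace TreeDecomposition

variable {V : Type*} {G : SimpleGraph V} (D : TreeDecomposition G)

theorem exists_mem_bag (v : V) : ∃ μ, v ∈ D.bag μ := by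
  obtain ⟨⟨μ, hμ⟩⟩ := (D.connected_nodes v).nonempty
  exact ⟨μ, hμ⟩

theorem card_bag_le (μ : D.Node) : (D.bag μ).card ≤ D.width + 1 := by
  have : (D.bag μ).card ≤ Finset.univ.sup (fun μ : D.Node => (D.bag μ).card) :=
    Finset.le_sup (f := fun μ : D.Node => (D.bag μ).card) (Finset.mem_univ μ)
  unfold width
  omega

/-- The nodes whose bags contain `v` form a connected subgraph, which avoids `μ`. Hence `side` does
not depend on the chosen node. -/
theorem reachable_compl {v : V} {μ ν ν' : D.Node} (hμ : v ∉ D.bag μ) (hν : v ∈ D.bag ν)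
    (hν' : v ∈ D.bag ν') (h : ν ∈ ({μ}ᶜ : Set D.Node)) (h' : ν' ∈ ({μ}ᶜ : Set D.Node)) :
    (D.tree.induce ({μ}ᶜ : Set D.Node)).Reachable ⟨ν, h⟩ ⟨ν', h'⟩ := by
  have hle : {μ | v ∈ D.bag μ} ⊆ ({μ}ᶜ : Set D.Node) := fun x hx h => hμ (h ▸ hx)
  exact ((D.connected_nodes v).preconnected ⟨ν, hν⟩ ⟨ν', hν'⟩).map
    (SimpleGraph.induceHomOfLE D.tree hle).toHom

/-- The component, in the tree without `μ`, of the nodes whose bags contain `v`. -/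
noncomputable def side (μ : D.Node) (v : V) :
    Option (D.tree.induce ({μ}ᶜ : Set D.Node)).ConnectedComponent :=
  open Classical in
  if h : v ∈ D.bag μ then none else
    some ((D.tree.induce ({μ}ᶜ : Set D.Node)).connectedComponentMk
      ⟨(D.exists_mem_bag v).choose, fun e => h (e ▸ (D.exists_mem_bag v).choose_spec)⟩)

theorem side_eq_none {μ : D.Node} {v : V} : D.side μ v = none ↔ v ∈ D.bag μ := by
  unfold side
  split_ifs <;> simp_all

theorem side_eq_some {μ ν : D.Node} {v : V} (h : v ∉ D.bag μ) (hν : v ∈ D.bag ν)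
    (hne : ν ∈ ({μ}ᶜ : Set D.Node)) :
    D.side μ v = some ((D.tree.induce ({μ}ᶜ : Set D.Node)).connectedComponentMk ⟨ν, hne⟩) := by
  unfold side
  rw [dif_neg h]
  congr 1
  rw [SimpleGraph.ConnectedComponent.eq]
  exact D.reachable_compl h (D.exists_mem_bag v).choose_spec hν _ _

theorem side_eq_of_adj {μ : D.Node} {u v : V} (hu : u ∉ D.bag μ) (hv : v ∉ D.bag μ)
    (h : G.Adj u v) : D.side μ u = D.side μ v := by
  obtain ⟨ν, h1, h2⟩ := D.exists_bag u v h
  have hne : ν ∈ ({μ}ᶜ : Set D.Node) := fun e => hu (e ▸ h1)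
  rw [D.side_eq_some hu h1 hne, D.side_eq_some hv h2 hne]

/-- A centroid: a bag all of whose components have at most half of the weight. -/
theorem exists_centroid [Fintype V] (w : V → ℕ) :
    ∃ μ : D.Node, ∀ c, open Classical in
      2 * ∑ v with D.side μ v = some c, w v ≤ ∑ v, w v := by
  classical
  by_contra! hcon
  choose c hc using hcon
  -- If there is no centroid, every node points along an edge to a component with more than half of
  -- the weight.
  choose f hadj hf hfc using fun μ => D.isTree.connected.exists_adj_mem_component μ (c μ)
  have hcard := D.isTree.card_edgeFinset
  -- A tree has fewer edges than nodes, so two nodes point at each other; their heavy components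
  -- hold disjoint sets of vertices, of total weight more than the whole.
  obtain ⟨μ, -, ν, -, hne, heq⟩ := Finset.exists_ne_map_eq_of_card_lt_of_maps_to
    (s := (Finset.univ : Finset D.Node)) (t := D.tree.edgeFinset)
    (by rw [Finset.card_univ]; omega) (f := fun μ => s(μ, f μ))
    (fun μ _ => by simpa using hadj μ)
  have h1 : f μ = ν ∧ f ν = μ := by
    simp only [Sym2.eq_iff] at heq
    rcases heq with ⟨h, -⟩ | ⟨h, h'⟩
    · exact absurd h hne
    · exact ⟨h', h.symm⟩
  have hdisj : Disjoint ({v | D.side μ v = some (c μ)} : Finset V)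
      ({v | D.side ν v = some (c ν)} : Finset V) := by
    rw [Finset.disjoint_left]
    intro v hv hv'
    simp only [Finset.mem_filter, Finset.mem_univ, true_and] at hv hv'
    have hvμ : v ∉ D.bag μ := fun h => by rw [D.side_eq_none.2 h] at hv; cases hv
    have hvν : v ∉ D.bag ν := fun h => by rw [D.side_eq_none.2 h] at hv'; cases hv'
    obtain ⟨x, hx⟩ := D.exists_mem_bag v
    have hxμ : x ∈ ({μ}ᶜ : Set D.Node) := fun e => hvμ (e ▸ hx)
    have hxν : x ∈ ({ν}ᶜ : Set D.Node) := fun e => hvν (e ▸ hx)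
    rw [D.side_eq_some hvμ hx hxμ, ← hfc, Option.some_inj, SimpleGraph.ConnectedComponent.eq] at hv
    rw [D.side_eq_some hvν hx hxν, ← hfc, Option.some_inj, SimpleGraph.ConnectedComponent.eq] at hv'
    have hμν := hadj μ
    have a1 := hf μ
    have a2 := hf ν
    simp only [h1.1, h1.2] at hv hv' hμν a1 a2
    exact D.isTree.isAcyclic.not_reachable_both hμν a1 a2 hxμ hxν hv hv'
  have h2 := hc μ
  have h3 := hc ν
  have h4 := Finset.sum_union (f := w) hdisj
  have h5 := Finset.sum_le_sum_of_subset (f := w) (Finset.subset_univ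
    (({v | D.side μ v = some (c μ)} : Finset V) ∪ ({v | D.side ν v = some (c ν)} : Finset V)))
  omega

/-- A bag separates the vertices outside of it into two parts, each with at most three quarters
of the total weight. -/
theorem exists_balanced_separator [Fintype V] (w : V → ℕ) :
    ∃ S : Finset V, S.card ≤ D.width + 1 ∧ ∃ f : V → Bool,
      (∀ u v, u ∉ S → v ∉ S → G.Adj u v → f u = f v) ∧
      ∀ b, open Classical in 4 * ∑ v with v ∉ S ∧ f v = b, w v ≤ 3 * ∑ v, w v := by
  classical
  obtain ⟨μ, hμ⟩ := D.exists_centroid w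
  have : Finite (D.tree.induce ({μ}ᶜ : Set D.Node)).ConnectedComponent := inferInstance
  have := Fintype.ofFinite (D.tree.induce ({μ}ᶜ : Set D.Node)).ConnectedComponent
  have hfib : ∀ t : Finset (Option (D.tree.induce ({μ}ᶜ : Set D.Node)).ConnectedComponent),
      ∑ c ∈ t, ∑ v with D.side μ v = c, w v = ∑ v with D.side μ v ∈ t, w v := by
    intro t
    rw [← Finset.sum_fiberwise_of_maps_to (s := ({v | D.side μ v ∈ t} : Finset V)) (t := t)
      (g := D.side μ) (fun v hv => by simpa using hv)]
    refine Finset.sum_congr rfl fun c hc => Finset.sum_congr ?_ fun _ _ => rfl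
    ext v
    simp only [Finset.mem_filter, Finset.mem_univ, true_and]
    exact ⟨fun h => ⟨h ▸ hc, h⟩, fun h => h.2⟩
  -- The value `none` stands for the vertices in the separating bag, so only the proper components
  -- are distributed.
  obtain ⟨t, hts, h1, h2⟩ := exists_balanced_subset (Finset.univ.erase none)
    (fun c => ∑ v with D.side μ v = c, w v) (∑ v, w v)
    (fun c hc => by
      cases c with
      | none => simp at hc
      | some c => exact hμ c)
    (by rw [hfib]; exact Finset.sum_le_sum_of_subset (Finset.subset_univ _))
  refine ⟨D.bag μ, D.card_bag_le μ, fun v => decide (D.side μ v ∈ t), ?_, ?_⟩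
  · intro u v hu hv h
    simp only [D.side_eq_of_adj hu hv h]
  · rw [hfib] at h1 h2
    intro b
    cases b
    · convert h2 using 3
      ext v
      simp [← D.side_eq_none]
    · convert h1 using 3
      ext v
      simp only [Finset.mem_filter, Finset.mem_univ, true_and, decide_eq_true_eq,
        ← D.side_eq_none]
      exact ⟨fun h => h.2, fun h => ⟨fun h' => Finset.ne_of_mem_erase (hts (h' ▸ h)) rfl, h⟩⟩

end TreeDecomposition

/-! ### Planar layouts -/

/-- Two cells of the planar grid are adjacent. -/
def CellAdj (p q : ℤ × ℤ) : Prop := |p.1 - q.1| + |p.2 - q.2| = 1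

/-- Two cells are linked in `M` if there is a path of adjacent cells in `M` between them. -/
def Linked (M : ℤ × ℤ → Prop) : ℤ × ℤ → ℤ × ℤ → Prop :=
  Relation.ReflTransGen fun p q => M p ∧ M q ∧ CellAdj p q

namespace Linked

variable {M M' : ℤ × ℤ → Prop} {p q r : ℤ × ℤ}

theorem refl : Linked M p p := Relation.ReflTransGen.refl

theorem trans (h : Linked M p q) (h' : Linked M q r) : Linked M p r :=
  Relation.ReflTransGen.trans h h'

theorem single (hp : M p) (hq : M q) (h : CellAdj p q) : Linked M p q :=
  Relation.ReflTransGen.single ⟨hp, hq, h⟩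

theorem symm (h : Linked M p q) : Linked M q p := by
  induction h with
  | refl => exact refl
  | tail _ h ih =>
    refine (single h.2.1 h.1 ?_).trans ih
    have := h.2.2
    unfold CellAdj at this ⊢
    rwa [abs_sub_comm, abs_sub_comm (Prod.snd _)]

theorem map (e : ℤ × ℤ → ℤ × ℤ) (hM : ∀ p, M p → M' (e p))
    (he : ∀ p q, CellAdj p q → CellAdj (e p) (e q)) (h : Linked M p q) :
    Linked M' (e p) (e q) := by
  induction h with
  | refl => exact refl
  | tail _ h ih => exact ih.trans (single (hM _ h.1) (hM _ h.2.1) (he _ _ h.2.2))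

theorem mono (hM : ∀ p, M p → M' p) (h : Linked M p q) : Linked M' p q :=
  h.map id hM fun _ _ => id

theorem mem_right (h : Linked M p q) (hp : M p) : M q := by
  rcases Relation.ReflTransGen.cases_tail h with h | ⟨_, _, h⟩
  · exact h ▸ hp
  · exact h.2.1

theorem vertical (x : ℤ) (n : ℕ) (h : ∀ t : ℤ, 0 ≤ t → t ≤ n → M (x, t)) :
    Linked M (x, n) (x, 0) := by
  induction n with
  | zero => exact refl
  | succ n ih =>
    refine (single (h _ (by omega) le_rfl) (h n (by omega) (by push_cast; omega)) ?_).trans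
      (ih fun t h0 h1 => h t h0 (by push_cast; omega))
    simp [CellAdj]

theorem horizontal (y : ℤ) (n : ℕ) (h : ∀ t : ℤ, 0 ≤ t → t ≤ n → M (t, y)) :
    Linked M (n, y) (0, y) := by
  induction n with
  | zero => exact refl
  | succ n ih =>
    refine (single (h _ (by omega) le_rfl) (h n (by omega) (by push_cast; omega)) ?_).trans
      (ih fun t h0 h1 => h t h0 (by push_cast; omega))
    simp [CellAdj]

end Linked

/-- A layout of the part of `G` induced by `X` together with its boundary `B`: each vertex occupies
some cells in a `W × H` box, such that vertices in the same cell have different colours. Each vertex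
of `X` has a home cell of its own, and adjacent vertices meet in the home cell of one of them.
The vertices of `B` can be extended to the outside through the corner of the box. -/
structure Layout {V : Type*} [DecidableEq V] (G : SimpleGraph V) (X B : Finset V) (K : ℕ)
    (col : V → ℕ) (W H : ℕ) where
  cells : Finset (ℤ × ℤ)
  Mem : V → ℤ × ℤ → Prop
  home : V → ℤ × ℤ
  mem_cells : ∀ {v p}, Mem v p → p ∈ cells
  box : ∀ {p}, p ∈ cells → 0 ≤ p.1 ∧ p.1 < W ∧ 0 ≤ p.2 ∧ p.2 < H
  mem_or : ∀ {v p}, Mem v p → v ∈ X ∨ v ∈ B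
  col_inj : ∀ {u v p}, Mem u p → Mem v p → col u = col v → u = v
  col_lt : ∀ {v p}, Mem v p → col v < K
  mem_home : ∀ {v}, v ∈ X → Mem v (home v)
  home_inj : Set.InjOn home X
  linked_home : ∀ {v p}, v ∈ X → Mem v p → Linked (Mem v) p (home v)
  linked_corner : ∀ {v p}, v ∈ B → Mem v p → Linked (Mem v) p (0, 0)
  edge : ∀ {u v}, u ∈ X → v ∈ X ∨ v ∈ B → G.Adj u v →
    Mem v (home u) ∨ v ∈ X ∧ Mem u (home v)

namespace Layout

variable {V : Type*} [DecidableEq V] {G : SimpleGraph V}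

/-- The empty layout. -/
def empty (B : Finset V) (K : ℕ) (col : V → ℕ) (W H : ℕ) : Layout G ∅ B K col W H where
  cells := ∅
  Mem := fun _ _ => False
  home := fun _ => 0
  mem_cells := False.elim
  box := by simp
  mem_or := False.elim
  col_inj := False.elim
  col_lt := False.elim
  mem_home := by simp
  home_inj := by simp
  linked_home := by simp
  linked_corner := fun _ => False.elim
  edge := by simp

/-- A layout remains one if the colours of the vertices outside of it change. -/
def congrCol {X B : Finset V} {K : ℕ} {col col' : V → ℕ} {W H : ℕ} (L : Layout G X B K col W H)
    (h : ∀ v, v ∈ X ∨ v ∈ B → col' v = col v) : Layout G X B K col' W H where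
  cells := L.cells
  Mem := L.Mem
  home := L.home
  mem_cells := L.mem_cells
  box := L.box
  mem_or := L.mem_or
  col_inj := fun hu hv he => L.col_inj hu hv (by rwa [h _ (L.mem_or hu), h _ (L.mem_or hv)] at he)
  col_lt := fun hv => by rw [h _ (L.mem_or hv)]; exact L.col_lt hv
  mem_home := L.mem_home
  home_inj := L.home_inj
  linked_home := L.linked_home
  linked_corner := L.linked_corner
  edge := L.edge

end Layout

/-! ### Packing and composing layouts -/

/-- Intervals of given lengths can be placed disjointly in an interval of the total length. -/
theorem exists_offsets {ι : Type*} [DecidableEq ι] (s : Finset ι) (l : ι → ℕ) :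
    ∃ off : ι → ℕ, (∀ i ∈ s, off i + l i ≤ ∑ i ∈ s, l i) ∧
      ∀ i ∈ s, ∀ j ∈ s, i ≠ j → off i + l i ≤ off j ∨ off j + l j ≤ off i := by
  induction s using Finset.induction_on with
  | empty => exact ⟨fun _ => 0, by simp⟩
  | insert a s ha ih =>
    obtain ⟨off, h1, h2⟩ := ih
    have hne : ∀ i ∈ s, i ≠ a := fun i hi h => ha (h ▸ hi)
    refine ⟨Function.update off a (∑ i ∈ s, l i), ?_, ?_⟩
    · intro i hi
      rw [Finset.sum_insert ha]
      rcases Finset.mem_insert.1 hi with rfl | hi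
      · simp [add_comm]
      · rw [Function.update_of_ne (hne i hi)]
        have := h1 i hi
        omega
    · intro i hi j hj hij
      rcases Finset.mem_insert.1 hi with hia | hi' <;>
        rcases Finset.mem_insert.1 hj with hja | hj'
      · exact absurd (hia.trans hja.symm) hij
      · rw [hia, Function.update_self, Function.update_of_ne (hne j hj')]
        exact Or.inr (h1 j hj')
      · rw [hja, Function.update_self, Function.update_of_ne (hne i hi')]
        exact Or.inl (h1 i hi')
      · rw [Function.update_of_ne (hne i hi'), Function.update_of_ne (hne j hj')]
        exact h2 i hi' j hj' hij

/-- A finite set can be mapped injectively into a set with at least as many elements. -/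
theorem exists_injOn_mapsTo {α β : Type*} [Nonempty β] (s : Finset α) (t : Finset β)
    (h : s.card ≤ t.card) : ∃ g : α → β, Set.InjOn g s ∧ ∀ a ∈ s, g a ∈ t := by
  classical
  obtain ⟨f⟩ := Function.Embedding.nonempty_of_card_le (α := s) (β := t) (by simpa using h)
  refine ⟨fun a => if h : a ∈ s then f ⟨a, h⟩ else Classical.arbitrary β, ?_, ?_⟩
  · intro a ha b hb hab
    have ha' : a ∈ s := ha
    have hb' : b ∈ s := hb
    simp only [dif_pos ha', dif_pos hb'] at hab
    exact congrArg Subtype.val (f.injective (Subtype.ext hab))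
  · intro a ha
    simp only [dif_pos ha]
    exact (f ⟨a, ha⟩).2

/-- A finite set can be placed injectively in a square. -/
theorem exists_injOn_square {V : Type*} (S : Finset V) (r : ℕ) (h : S.card ≤ r * r) :
    ∃ g : V → ℤ × ℤ, Set.InjOn g S ∧
      ∀ v ∈ S, 0 ≤ (g v).1 ∧ (g v).1 < r ∧ 0 ≤ (g v).2 ∧ (g v).2 < r := by
  obtain ⟨g, hg, hm⟩ := exists_injOn_mapsTo S (Finset.Ico (0 : ℤ) r ×ˢ Finset.Ico (0 : ℤ) r)
    (by simpa using h)
  refine ⟨g, hg, fun v hv => ?_⟩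
  have := hm v hv
  simp only [Finset.mem_product, Finset.mem_Ico] at this
  tauto

namespace Layout

variable {V : Type*} [DecidableEq V] {G : SimpleGraph V} {ι : Type*}

section compose

/-- A square with a bus to its right along the bottom. -/
noncomputable def bus (r n : ℕ) : Finset (ℤ × ℤ) :=
  Finset.Ico (0 : ℤ) r ×ˢ Finset.Ico (0 : ℤ) r ∪ Finset.Ico (r : ℤ) (r + n) ×ˢ {0}

theorem mem_bus {r n : ℕ} {p : ℤ × ℤ} : p ∈ bus r n ↔
    (0 ≤ p.1 ∧ p.1 < r ∧ 0 ≤ p.2 ∧ p.2 < r) ∨ (r ≤ p.1 ∧ p.1 < r + n ∧ p.2 = 0) := by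
  simp only [bus, Finset.mem_union, Finset.mem_product, Finset.mem_Ico, Finset.mem_singleton]
  tauto

theorem card_bus_le (r n : ℕ) : (bus r n).card ≤ r * r + n := by
  refine (Finset.card_union_le _ _).trans ?_
  simp

theorem linked_bus {r n : ℕ} {p : ℤ × ℤ} (hr : 0 < r) (hp : p ∈ bus r n) :
    Linked (· ∈ bus r n) p (0, 0) := by
  obtain ⟨x, y⟩ := p
  rw [mem_bus] at hp
  dsimp only at hp
  lift x to ℕ using by omega
  lift y to ℕ using by omega
  refine (Linked.vertical (x : ℤ) y fun t h0 h1 => ?_).trans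
    (Linked.horizontal 0 x fun t h0 h1 => ?_)
  · rw [mem_bus]; dsimp only; omega
  · rw [mem_bus]; dsimp only; omega

/-- The position of a cell of the child with offset `a`, which is drawn transposed. -/
def childPos (a : ℕ) (q : ℤ × ℤ) : ℤ × ℤ := (a + q.2, 1 + q.1)

theorem cellAdj_childPos (a : ℕ) (p q : ℤ × ℤ) (h : CellAdj p q) :
    CellAdj (childPos a p) (childPos a q) := by
  simp only [CellAdj, childPos, add_sub_add_left_eq_sub] at h ⊢
  rw [add_comm]; exact h

theorem childPos_injective (a : ℕ) : Function.Injective (childPos a) := by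
  intro p q h
  simp only [childPos, Prod.mk.injEq, add_right_inj] at h
  exact Prod.ext h.2 h.1

/-- The children stand side by side on the bus, from row 1 upwards, transposed: their heights add up
along the bus, and their widths only bound the height. The corner of each child lies directly above
a bus cell, so all boundary vertices of the child can be linked to the corner of the new box. -/
theorem exists_compose [Fintype ι] [DecidableEq ι] {X B S : Finset V} {K : ℕ} {col : V → ℕ}
    {Xi Bi : ι → Finset V} {W H : ι → ℕ} (L : ∀ i, Layout G (Xi i) (Bi i) K col (W i) (H i))
    (r h : ℕ) (hr : 0 < r) (hrh : r ≤ h) (hWh : ∀ i, 1 + W i ≤ h)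
    (hXB : Disjoint X B) (hSX : S ⊆ X) (hX : ∀ v, v ∈ X ↔ v ∈ S ∨ ∃ i, v ∈ Xi i)
    (hXi : ∀ i, Disjoint (Xi i) S) (hXij : ∀ i j v, v ∈ Xi i → v ∈ Xi j → i = j)
    (hBi : ∀ i, Bi i ⊆ B ∪ S)
    (hadj : ∀ i u v, u ∈ Xi i → v ∈ X ∨ v ∈ B → G.Adj u v → v ∈ Xi i ∨ v ∈ Bi i)
    (hcol : Set.InjOn col (B ∪ S : Finset V)) (hcolK : ∀ v ∈ B ∪ S, col v < K)
    (hS : S.card ≤ r * r) :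
    ∃ L' : Layout G X B K col (r + ∑ i, H i) h,
      L'.cells.card ≤ r * r + ∑ i, H i + ∑ i, (L i).cells.card := by
  classical
  obtain ⟨off, hoff, hoff'⟩ := exists_offsets Finset.univ H
  obtain ⟨g, hg, hgr⟩ := exists_injOn_square S r hS
  set n := ∑ i, H i with hn
  have hXiC : ∀ i v, v ∈ Xi i → v ∉ B ∪ S := by
    intro i v hv hv'
    rcases Finset.mem_union.1 hv' with h' | h'
    · exact Finset.disjoint_left.1 hXB ((hX v).2 (Or.inr ⟨i, hv⟩)) h'
    · exact Finset.disjoint_left.1 (hXi i) hv h'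
  let e : ι → ℤ × ℤ → ℤ × ℤ := fun i => childPos (r + off i)
  have hbox : ∀ i q, q ∈ (L i).cells → (r : ℤ) + off i ≤ (e i q).1 ∧
      (e i q).1 < r + off i + H i ∧ 1 ≤ (e i q).2 ∧ (e i q).2 < 1 + W i := by
    intro i q hq
    have := (L i).box hq
    simp only [e, childPos]
    push_cast
    omega
  have hoffz : ∀ i, (off i : ℤ) + H i ≤ n := fun i => by
    exact_mod_cast hoff i (Finset.mem_univ i)
  have he_bus : ∀ i q, q ∈ (L i).cells → e i q ∉ bus r n := by
    intro i q hq
    have := hbox i q hq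
    rw [mem_bus]
    omega
  have he_inj : ∀ i j q q', q ∈ (L i).cells → q' ∈ (L j).cells → e i q = e j q' →
      i = j ∧ q = q' := by
    intro i j q q' hq hq' heq
    have h1 := hbox i q hq
    have h2 := hbox j q' hq'
    rw [heq] at h1
    have hij : i = j := by
      by_contra hne
      have := hoff' i (Finset.mem_univ i) j (Finset.mem_univ j) hne
      omega
    subst hij
    exact ⟨rfl, childPos_injective _ heq⟩
  -- Every vertex of `B ∪ S` fills the whole square and bus, needed or not; distinct colours make
  -- this harmless.
  let M : V → ℤ × ℤ → Prop := fun v p =>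
    (p ∈ bus r n ∧ v ∈ B ∪ S) ∨ ∃ i q, (L i).Mem v q ∧ e i q = p
  have hM_child : ∀ i q v, (L i).Mem v q → M v (e i q) := fun i q v hv => Or.inr ⟨i, q, hv, rfl⟩
  have hM_bus : ∀ v, v ∈ B ∪ S → ∀ p, p ∈ bus r n → M v p := fun v hv p hp => Or.inl ⟨hp, hv⟩
  have hlink : ∀ v, v ∈ B ∪ S → ∀ p, M v p → Linked (M v) p (0, 0) := by
    rintro v hv p (⟨hp, -⟩ | ⟨i, q, hq, rfl⟩)
    · exact (linked_bus hr hp).mono (hM_bus v hv)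
    · have hvB : v ∈ Bi i := ((L i).mem_or hq).resolve_left fun h' => hXiC i v h' hv
      have h1 := (L i).linked_corner hvB hq
      have h2 := h1.mem_right hq
      have h3 := (L i).box ((L i).mem_cells h2)
      have h4 : ((r : ℤ) + off i, (0 : ℤ)) ∈ bus r n := by
        have := hoffz i
        rw [mem_bus]; dsimp only at h3 ⊢; omega
      refine (h1.map (M' := M v) (e i) (fun q hq => hM_child i q v hq)
        (cellAdj_childPos _)).trans (Linked.trans ?_ ((linked_bus hr h4).mono (hM_bus v hv)))
      refine Linked.single (hM_child i _ v h2) (hM_bus v hv _ h4) ?_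
      simp [CellAdj, e, childPos]
  have hg_bus : ∀ v ∈ S, g v ∈ bus r n := fun v hv => mem_bus.2 (Or.inl (hgr v hv))
  -- The value 0 is only taken outside of `X`, where homes are irrelevant.
  let hm : V → ℤ × ℤ := fun v =>
    if v ∈ S then g v else if h : ∃ i, v ∈ Xi i then e h.choose ((L h.choose).home v) else 0
  have hm_S : ∀ v ∈ S, hm v = g v := fun v hv => if_pos hv
  have hm_X : ∀ i v, v ∈ Xi i → hm v = e i ((L i).home v) := by
    intro i v hv
    have h1 : v ∉ S := Finset.disjoint_left.1 (hXi i) hv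
    have h2 : ∃ i, v ∈ Xi i := ⟨i, hv⟩
    have h3 : h2.choose = i := hXij _ _ v h2.choose_spec hv
    simp only [hm, if_neg h1, dif_pos h2]
    rw [h3]
  refine ⟨⟨bus r n ∪ Finset.univ.biUnion fun i => (L i).cells.image (e i), M, hm,
    ?_, ?_, ?_, ?_, ?_, ?_, ?_, ?_, ?_, ?_⟩, ?_⟩
  · rintro v p (⟨hp, -⟩ | ⟨i, q, hq, rfl⟩)
    · exact Finset.mem_union_left _ hp
    · exact Finset.mem_union_right _ (Finset.mem_biUnion.2 ⟨i, Finset.mem_univ i,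
        Finset.mem_image_of_mem _ ((L i).mem_cells hq)⟩)
  · intro p hp
    rcases Finset.mem_union.1 hp with hp | hp
    · rw [mem_bus] at hp
      push_cast
      omega
    · obtain ⟨i, -, hp⟩ := Finset.mem_biUnion.1 hp
      obtain ⟨q, hq, rfl⟩ := Finset.mem_image.1 hp
      have h1 := hbox i q hq
      have h2 := hWh i
      have h3 := hoffz i
      push_cast
      omega
  · rintro v p (⟨-, hv⟩ | ⟨i, q, hq, rfl⟩)
    · rcases Finset.mem_union.1 hv with hv | hv
      · exact Or.inr hv
      · exact Or.inl (hSX hv)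
    · rcases (L i).mem_or hq with hv | hv
      · exact Or.inl ((hX v).2 (Or.inr ⟨i, hv⟩))
      · rcases Finset.mem_union.1 (hBi i hv) with hv | hv
        · exact Or.inr hv
        · exact Or.inl (hSX hv)
  · rintro u v p (⟨hp, hu⟩ | ⟨i, q, hq, rfl⟩) (⟨hp', hv⟩ | ⟨j, q', hq', heq⟩) hc
    · exact hcol hu hv hc
    · exact absurd (heq ▸ hp) (he_bus j q' ((L j).mem_cells hq'))
    · exact absurd hp' (he_bus i q ((L i).mem_cells hq))
    · obtain ⟨rfl, rfl⟩ := he_inj j i q' q ((L j).mem_cells hq') ((L i).mem_cells hq) heq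
      exact (L j).col_inj hq hq' hc
  · rintro v p (⟨-, hv⟩ | ⟨i, q, hq, rfl⟩)
    · exact hcolK v hv
    · exact (L i).col_lt hq
  · intro v hv
    rcases (hX v).1 hv with hv | ⟨i, hv⟩
    · rw [hm_S v hv]
      exact hM_bus v (Finset.mem_union_right _ hv) _ (hg_bus v hv)
    · rw [hm_X i v hv]
      exact hM_child i _ v ((L i).mem_home hv)
  · intro u hu v hv huv
    rcases (hX u).1 hu with hu | ⟨i, hu⟩ <;> rcases (hX v).1 hv with hv | ⟨j, hv⟩
    · rw [hm_S u hu, hm_S v hv] at huv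
      exact hg hu hv huv
    · rw [hm_S u hu, hm_X j v hv] at huv
      exact absurd (huv ▸ hg_bus u hu) (he_bus j _ ((L j).mem_cells ((L j).mem_home hv)))
    · rw [hm_X i u hu, hm_S v hv] at huv
      exact absurd (huv ▸ hg_bus v hv) (he_bus i _ ((L i).mem_cells ((L i).mem_home hu)))
    · rw [hm_X i u hu, hm_X j v hv] at huv
      obtain ⟨rfl, h'⟩ := he_inj i j _ _ ((L i).mem_cells ((L i).mem_home hu))
        ((L j).mem_cells ((L j).mem_home hv)) huv
      exact (L i).home_inj hu hv h'
  · intro v p hv hp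
    rcases (hX v).1 hv with hv | ⟨i, hv⟩
    · have hvC := Finset.mem_union_right B hv
      rw [hm_S v hv]
      exact (hlink v hvC p hp).trans (hlink v hvC _ (hM_bus v hvC _ (hg_bus v hv))).symm
    · rw [hm_X i v hv]
      rcases hp with ⟨-, hv'⟩ | ⟨j, q, hq, rfl⟩
      · exact absurd hv' (hXiC i v hv)
      · have hj : v ∈ Xi j := ((L j).mem_or hq).resolve_right fun h' => hXiC i v hv (hBi j h')
        obtain rfl := hXij i j v hv hj
        exact ((L i).linked_home hv hq).map (e i) (fun q hq => hM_child i q v hq)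
          (cellAdj_childPos _)
  · intro v p hv hp
    exact hlink v (Finset.mem_union_left _ hv) p hp
  · intro u v hu hv huv
    rcases (hX u).1 hu with huS | ⟨i, hui⟩
    · by_cases hvC : v ∈ B ∪ S
      · left
        rw [hm_S u huS]
        exact hM_bus v hvC _ (hg_bus u huS)
      · have hvX : v ∈ X := hv.resolve_right fun h' => hvC (Finset.mem_union_left _ h')
        obtain ⟨i, hvi⟩ := ((hX v).1 hvX).resolve_left fun h' => hvC (Finset.mem_union_right _ h')
        right
        refine ⟨hvX, ?_⟩
        rw [hm_X i v hvi]
        -- An edge between `S` and a child is realised inside the child. There `u` is only a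
        -- boundary vertex, so the meeting point must be the home of `v`.
        have hu' := hadj i v u hvi (Or.inl hu) huv.symm
        rcases (L i).edge hvi hu' huv.symm with h' | ⟨h', -⟩
        · exact hM_child i _ u h'
        · exact absurd (Finset.mem_union_right B huS) (hXiC i u h')
    · rcases (L i).edge hui (hadj i u v hui hv huv) huv with h' | ⟨hvi, h'⟩
      · left
        rw [hm_X i u hui]
        exact hM_child i _ v h'
      · right
        refine ⟨(hX v).2 (Or.inr ⟨i, hvi⟩), ?_⟩
        rw [hm_X i v hvi]
        exact hM_child i _ u h'
  · refine (Finset.card_union_le _ _).trans (Nat.add_le_add (card_bus_le r n) ?_)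
    exact Finset.card_biUnion_le.trans (Finset.sum_le_sum fun i _ => Finset.card_image_le)

end compose

end Layout

/-! ### Numerical estimates for the recursion -/

section Estimates

/-- The scale of the side lengths of the layout of a graph with `x` vertices. -/
noncomputable def scale (x : ℝ) : ℝ := x ^ (9 / 10 : ℝ)

/-- Reduces numerical bounds on powers with exponent in tenths to rational arithmetic. -/
theorem rpow_le_of_pow_le {a b : ℝ} (ha : 0 ≤ a) (hb : 0 ≤ b) {k : ℕ} (h : a ^ k ≤ b ^ 10) :
    a ^ ((k : ℝ) / 10) ≤ b := by
  have h1 : a ^ ((k : ℝ) / 10) = (a ^ k) ^ (1 / 10 : ℝ) := by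
    rw [← Real.rpow_natCast, ← Real.rpow_mul ha]; congr 1; ring
  have h2 : (b ^ 10) ^ (1 / 10 : ℝ) = b := by
    rw [← Real.rpow_natCast, ← Real.rpow_mul hb]; norm_num
  rw [h1, ← h2]
  exact Real.rpow_le_rpow (by positivity) h (by norm_num)

theorem one_le_scale {x : ℝ} (hx : 1 ≤ x) : 1 ≤ scale x :=
  Real.one_le_rpow hx (by norm_num)

theorem scale_le_of_le {x m : ℝ} (hx : 0 ≤ x) (h : 4 * x ≤ 3 * m) :
    scale x ≤ 0.773 * scale m := by
  have hm : 0 ≤ m := by linarith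
  have h1 : scale x ≤ scale (3 / 4 * m) :=
    Real.rpow_le_rpow hx (by linarith) (by norm_num)
  have h2 : scale (3 / 4 * m) = (3 / 4 : ℝ) ^ (9 / 10 : ℝ) * scale m :=
    Real.mul_rpow (by norm_num) hm
  have h3 : (3 / 4 : ℝ) ^ (9 / 10 : ℝ) ≤ 0.773 := by
    have := rpow_le_of_pow_le (a := 3 / 4) (b := 0.773) (k := 9) (by norm_num) (by norm_num)
      (by norm_num)
    exact_mod_cast this
  rw [h2] at h1
  exact h1.trans (mul_le_mul_of_nonneg_right h3 (Real.rpow_nonneg hm _))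

/-- By concavity the worst case is four equal parts, with factor `4 ^ (1 / 10) < 1.15`. -/
theorem sum_scale_le {ι : Type*} [Fintype ι] (hι : Fintype.card ι = 4) (x : ι → ℝ)
    (hx : ∀ i, 0 ≤ x i) : ∑ i, scale (x i) ≤ 1.15 * scale (∑ i, x i) := by
  have h := (Real.concaveOn_rpow (p := 9 / 10) (by norm_num) (by norm_num)).le_map_sum
    (t := Finset.univ) (w := fun _ : ι => (1 / 4 : ℝ)) (p := x) (fun _ _ => by norm_num)
    (by simp [hι]) (fun i _ => hx i)
  simp only [smul_eq_mul, ← Finset.mul_sum] at h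
  have hs : 0 ≤ ∑ i, x i := Finset.sum_nonneg fun i _ => hx i
  rw [Real.mul_rpow (by norm_num) hs] at h
  have h1 : (1 / 4 : ℝ) ^ (9 / 10 : ℝ) ≤ 1.15 / 4 := by
    have := rpow_le_of_pow_le (a := 1 / 4) (b := 1.15 / 4) (k := 9) (by norm_num) (by norm_num)
      (by norm_num)
    exact_mod_cast this
  have h2 := mul_le_mul_of_nonneg_right h1 (Real.rpow_nonneg hs (9 / 10))
  unfold scale
  linarith

/-- Since `x ^ 0.9 = x ^ (-0.1) * x` and each part is at most `3 * m / 4`, each part contributes at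
least `(3 / 4) ^ (-0.1) ≥ 1.02` times `m ^ (-0.1) * x`. -/
theorem le_sum_scale {ι : Type*} [Fintype ι] {m s : ℝ} (hm : 1 ≤ m) (hs : 0 ≤ s) (x : ι → ℝ)
    (hx : ∀ i, 0 ≤ x i) (hxm : ∀ i, 4 * x i ≤ 3 * m) (hsum : s + ∑ i, x i = m) :
    1.02 * (scale m - s) ≤ ∑ i, scale (x i) := by
  have hm0 : 0 < m := by linarith
  have hpow : m * m ^ (-(1 / 10) : ℝ) = scale m := by
    have := Real.rpow_add hm0 1 (-(1 / 10))
    rw [Real.rpow_one] at this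
    rw [← this, scale]; norm_num
  have hle : m ^ (-(1 / 10) : ℝ) ≤ 1 := Real.rpow_le_one_of_one_le_of_nonpos hm (by norm_num)
  have hpos : 0 < m ^ (-(1 / 10) : ℝ) := Real.rpow_pos_of_pos hm0 _
  have hc : (1.02 : ℝ) ≤ (3 / 4 : ℝ) ^ (-(1 / 10) : ℝ) := by
    have h1 := rpow_le_of_pow_le (a := 3 / 4) (b := 1 / 1.02) (k := 1) (by norm_num) (by norm_num)
      (by norm_num)
    rw [Nat.cast_one] at h1
    rw [Real.rpow_neg (by norm_num)]
    have h2 : (0 : ℝ) < (3 / 4 : ℝ) ^ (1 / 10 : ℝ) := by positivity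
    rw [le_inv_comm₀ (by norm_num) h2]
    simpa using h1
  have key : ∀ i, 1.02 * m ^ (-(1 / 10) : ℝ) * x i ≤ scale (x i) := by
    intro i
    rcases (hx i).eq_or_lt with h0 | h0
    · rw [← h0, mul_zero]; exact Real.rpow_nonneg le_rfl _
    · have h1 : scale (x i) = x i ^ (-(1 / 10) : ℝ) * x i := by
        have := Real.rpow_add h0 (-(1 / 10)) 1
        rw [Real.rpow_one] at this
        rw [← this, scale]; norm_num
      rw [h1]
      refine mul_le_mul_of_nonneg_right ?_ h0.le
      calc 1.02 * m ^ (-(1 / 10) : ℝ) ≤ (3 / 4 : ℝ) ^ (-(1 / 10) : ℝ) * m ^ (-(1 / 10) : ℝ) :=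
            mul_le_mul_of_nonneg_right hc hpos.le
        _ = (3 / 4 * m) ^ (-(1 / 10) : ℝ) := (Real.mul_rpow (by norm_num) hm0.le).symm
        _ ≤ x i ^ (-(1 / 10) : ℝ) :=
            Real.rpow_le_rpow_of_nonpos h0 (by linarith [hxm i]) (by norm_num)
  have h1 := Finset.sum_le_sum fun i (_ : i ∈ Finset.univ) => key i
  rw [← Finset.mul_sum] at h1
  have h2 : ∑ i, x i = m - s := by linarith
  rw [h2] at h1
  have h3 : m ^ (-(1 / 10) : ℝ) * s ≤ s := mul_le_of_le_one_left hs hle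
  nlinarith

theorem sqrt_add_one_le_scale {s m : ℕ} (hs : s ≤ m) (hm : 1 ≤ m) :
    ((Nat.sqrt s + 1 : ℕ) : ℝ) ≤ 2 * scale m := by
  have hm' : (1 : ℝ) ≤ m := by exact_mod_cast hm
  have h1 : (Nat.sqrt s : ℝ) ≤ √(m : ℝ) := by
    refine Real.le_sqrt_of_sq_le ?_
    exact_mod_cast (Nat.sqrt_le' s).trans hs
  have h2 : √(m : ℝ) ≤ scale m := by
    rw [Real.sqrt_eq_rpow]
    exact Real.rpow_le_rpow_of_exponent_le hm' (by norm_num)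
  have := one_le_scale hm'
  push_cast
  linarith

theorem sqrt_add_one_mul_self_le (s : ℕ) : (Nat.sqrt s + 1) * (Nat.sqrt s + 1) ≤ 4 * s + 1 := by
  have h := Nat.sqrt_le s
  have h' : Nat.sqrt s ≤ Nat.sqrt s * Nat.sqrt s := Nat.le_mul_self _
  have h2 : (Nat.sqrt s + 1) * (Nat.sqrt s + 1) =
    Nat.sqrt s * Nat.sqrt s + 2 * Nat.sqrt s + 1 := by ring
  omega

end Estimates

/-! ### The recursive construction of a layout -/

namespace Layout

variable {V : Type*} [DecidableEq V] {G : SimpleGraph V}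

/-- An injective colouring with less than `K` colours extends to a larger set. -/
theorem exists_extend_coloring (B S : Finset V) (K : ℕ) (col : V → ℕ) (hcol : Set.InjOn col B)
    (hK : ∀ v ∈ B, col v < K) (hd : Disjoint B S) (hc : B.card + S.card ≤ K) :
    ∃ col' : V → ℕ, (∀ v, v ∉ S → col' v = col v) ∧ Set.InjOn col' (B ∪ S : Finset V) ∧
      ∀ v ∈ B ∪ S, col' v < K := by
  obtain ⟨g, hg, hm⟩ := exists_injOn_mapsTo S (Finset.range K \ B.image col) (by
    have h1 := Finset.le_card_sdiff (B.image col) (Finset.range K)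
    have h2 : (B.image col).card ≤ B.card := Finset.card_image_le
    rw [Finset.card_range] at h1
    omega)
  simp only [Finset.mem_sdiff, Finset.mem_range, Finset.mem_image, not_exists, not_and] at hm
  have hB : ∀ v ∈ B, v ∉ S := fun v hv => Finset.disjoint_left.1 hd hv
  refine ⟨fun v => if v ∈ S then g v else col v, fun v hv => if_neg hv, ?_, ?_⟩
  · intro u hu v hv huv
    simp only at huv
    rcases Finset.mem_union.1 hu with hu | hu <;> rcases Finset.mem_union.1 hv with hv | hv
    · rw [if_neg (hB u hu), if_neg (hB v hv)] at huv
      exact hcol hu hv huv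
    · rw [if_neg (hB u hu), if_pos hv] at huv
      exact absurd huv ((hm v hv).2 u hu)
    · rw [if_pos hu, if_neg (hB v hv)] at huv
      exact absurd huv.symm ((hm u hu).2 v hv)
    · rw [if_pos hu, if_pos hv] at huv
      exact hg hu hv huv
  · intro v hv
    rcases Finset.mem_union.1 hv with hv | hv
    · simp only [if_neg (hB v hv)]; exact hK v hv
    · simp only [if_pos hv]; exact (hm v hv).1

/-- One step of the recursive decomposition of a graph with small separators. -/
theorem exists_split [Fintype V] (D : TreeDecomposition G) (X B : Finset V)
    (hB : B.card ≤ 8 * (D.width + 1)) :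
    ∃ (S : Finset V) (Xi Bi : Bool × Bool → Finset V), S ⊆ X ∧ S.card ≤ 2 * (D.width + 1) ∧
      (∀ v, v ∈ X ↔ v ∈ S ∨ ∃ i, v ∈ Xi i) ∧ (∀ i, Disjoint (Xi i) S) ∧
      (∀ i j v, v ∈ Xi i → v ∈ Xi j → i = j) ∧ (∀ i, Bi i ⊆ B ∪ S) ∧
      (∀ i u v, u ∈ Xi i → v ∈ X ∨ v ∈ B → G.Adj u v → v ∈ Xi i ∨ v ∈ Bi i) ∧
      (∀ i, (Bi i).card ≤ 8 * (D.width + 1)) ∧ (∀ i, 4 * (Xi i).card ≤ 3 * X.card) ∧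
      S.card + ∑ i, (Xi i).card = X.card := by
  classical
  obtain ⟨S₁, hS₁, f, hf, hf'⟩ := D.exists_balanced_separator (fun v => if v ∈ X then 1 else 0)
  obtain ⟨S₂, hS₂, g, hg, hg'⟩ := D.exists_balanced_separator (fun v => if v ∈ B then 1 else 0)
  have hcS : (S₁ ∪ S₂).card ≤ 2 * (D.width + 1) := (Finset.card_union_le _ _).trans (by omega)
  have hcount : ∀ (Y : Finset V) (P : V → Prop) [DecidablePred P],
      ∑ v with P v, (if v ∈ Y then 1 else 0) = (Y.filter P).card := by
    intro Y P _
    rw [← Finset.sum_filter, Finset.filter_filter, Finset.card_eq_sum_ones]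
    refine Finset.sum_congr ?_ fun _ _ => rfl
    ext v
    simp [and_comm]
  have hcount' : ∀ Y : Finset V, ∑ v, (if v ∈ Y then 1 else 0) = Y.card := by
    intro Y; simp
  simp only [hcount, hcount'] at hf' hg'
  -- Three quarters of the old boundary and two bags: 6 + 2 = 8 times `D.width + 1`.
  have hcard : ∀ i : Bool × Bool, (B.filter fun v => v ∉ S₂ ∧ g v = i.2).card +
      (S₁ ∪ S₂).card ≤ 8 * (D.width + 1) := fun i => by
    have h : 4 * (B.filter fun v => v ∉ S₂ ∧ g v = i.2).card ≤ 3 * B.card := by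
      convert hg' i.2
    omega
  refine ⟨X.filter (· ∈ S₁ ∪ S₂), fun i => X.filter fun v => v ∉ S₁ ∪ S₂ ∧ (f v, g v) = i,
    fun i => (B.filter fun v => v ∈ S₁ ∪ S₂ ∨ (f v, g v) = i) ∪ X.filter (· ∈ S₁ ∪ S₂),
    Finset.filter_subset _ _, ?_, ?_, ?_, ?_, ?_, ?_, ?_, ?_, ?_⟩
  · refine (Finset.card_le_card ?_).trans hcS
    intro v hv
    exact (Finset.mem_filter.1 hv).2
  · intro v
    simp only [Finset.mem_filter]
    by_cases h : v ∈ S₁ ∪ S₂ <;> simp [h]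
  · intro i
    rw [Finset.disjoint_left]
    intro v hv hv'
    exact (Finset.mem_filter.1 hv).2.1 (Finset.mem_filter.1 hv').2
  · intro i j v hv hv'
    exact (Finset.mem_filter.1 hv).2.2.symm.trans (Finset.mem_filter.1 hv').2.2
  · intro i
    exact Finset.union_subset_union_left (Finset.filter_subset _ _)
  · intro i u v hu hv huv
    simp only [Finset.mem_filter, Finset.mem_union] at hu ⊢
    by_cases hvS : v ∈ S₁ ∨ v ∈ S₂
    · tauto
    · have e1 := hf u v (by tauto) (by tauto) huv
      have e2 := hg u v (by tauto) (by tauto) huv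
      rw [← e1, ← e2]
      tauto
  · intro i
    refine le_trans (Finset.card_le_card ?_) ((Finset.card_union_le _ _).trans (hcard i))
    intro v hv
    simp only [Finset.mem_filter, Finset.mem_union] at hv ⊢
    by_cases hvS : v ∈ S₁ ∨ v ∈ S₂
    · exact Or.inr hvS
    · have h1 : v ∈ B ∧ (f v, g v) = i := by tauto
      exact Or.inl ⟨h1.1, fun h => hvS (Or.inr h), by rw [← h1.2]⟩
  · intro i
    refine le_trans (Nat.mul_le_mul_left 4 (Finset.card_le_card ?_)) (hf' i.1)
    intro v hv
    simp only [Finset.mem_filter, Finset.mem_union, not_or] at hv ⊢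
    exact ⟨hv.1, hv.2.1.1, by rw [← hv.2.2]⟩
  · rw [← Finset.card_filter_add_card_filter_not (s := X) (· ∈ S₁ ∪ S₂)]
    congr 1
    rw [Finset.card_eq_sum_card_fiberwise (f := fun v => (f v, g v)) (t := Finset.univ)
      (fun _ _ => by simp)]
    refine Finset.sum_congr rfl fun i _ => ?_
    rw [Finset.filter_filter]

/-- A graph with a tree decomposition of width `k` has a layout with a linear number of cells and
`10 * (k + 1)` colours. -/
theorem exists_layout [Fintype V] (D : TreeDecomposition G) (m : ℕ) :
    ∀ (X B : Finset V) (col : V → ℕ), X.card = m → Disjoint X B → B.card ≤ 8 * (D.width + 1) →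
      Set.InjOn col B → (∀ v ∈ B, col v < 10 * (D.width + 1)) →
      ∃ (col' : V → ℕ) (W H : ℕ) (L : Layout G X B (10 * (D.width + 1)) col' W H),
        (∀ v, v ∉ X → col' v = col v) ∧ (W : ℝ) ≤ 28.45 * scale m ∧ (H : ℝ) ≤ 23 * scale m ∧
        (L.cells.card : ℝ) ≤ 1228 * m - 1223 * scale m := by
  classical
  induction m using Nat.strong_induction_on with
  | _ m ih =>
  intro X B col hXm hXB hB hcol hK
  rcases Nat.eq_zero_or_pos m with rfl | hm
  · obtain rfl := Finset.card_eq_zero.1 hXm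
    refine ⟨col, 0, 0, empty _ _ _ _ _, fun _ _ => rfl, ?_, ?_, ?_⟩ <;>
      simp [empty, scale]
  obtain ⟨S, Xi, Bi, hSX, hS, hX, hXi, hXij, hBi, hadj, hBcard, hXcard, hsum⟩ :=
    exists_split D X B hB
  obtain ⟨col₁, hcol₁, hinj₁, hK₁⟩ := exists_extend_coloring B S (10 * (D.width + 1)) col hcol hK
    (hXB.symm.mono_right hSX) (by omega)
  rw [hXm] at hXcard hsum
  have hXiC : ∀ i v, v ∈ Xi i → v ∉ B ∪ S := by
    intro i v hv hv'
    rcases Finset.mem_union.1 hv' with h' | h'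
    · exact Finset.disjoint_left.1 hXB ((hX v).2 (Or.inr ⟨i, hv⟩)) h'
    · exact Finset.disjoint_left.1 (hXi i) hv h'
  -- The colours of `B ∪ S` are fixed before the recursion, so a vertex on the boundary of several
  -- children has the same colour in all of them.
  choose coli W H L hcoli hW hH hL using fun i =>
    ih (Xi i).card (by have := hXcard i; omega) (Xi i) (Bi i) col₁ rfl
      (Finset.disjoint_left.2 fun v hv hv' => hXiC i v hv (hBi i hv')) (hBcard i)
      (hinj₁.mono (by exact_mod_cast hBi i)) (fun v hv => hK₁ v (hBi i hv))
  let col' : V → ℕ := fun v => if h : ∃ i, v ∈ Xi i then coli h.choose v else col₁ v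
  have hcol'_X : ∀ i v, v ∈ Xi i → col' v = coli i v := by
    intro i v hv
    have h : ∃ i, v ∈ Xi i := ⟨i, hv⟩
    have h' : h.choose = i := hXij _ _ v h.choose_spec hv
    simp only [col', dif_pos h, h']
  have hcol'_not : ∀ v, (∀ i, v ∉ Xi i) → col' v = col₁ v := by
    intro v hv
    have h : ¬∃ i, v ∈ Xi i := fun ⟨i, hi⟩ => hv i hi
    simp only [col', dif_neg h]
  have hcol'_C : ∀ v ∈ B ∪ S, col' v = col₁ v := fun v hv =>
    hcol'_not v fun i hi => hXiC i v hi hv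
  have hm' : (1 : ℝ) ≤ m := by exact_mod_cast hm
  have hsc := one_le_scale hm'
  have hsm : S.card ≤ m := hXm ▸ Finset.card_le_card hSX
  have hr := sqrt_add_one_le_scale hsm hm
  have hx : ∀ i, 4 * ((Xi i).card : ℝ) ≤ 3 * m := fun i => by exact_mod_cast hXcard i
  have hsumR : (S.card : ℝ) + ∑ i, ((Xi i).card : ℝ) = m := by exact_mod_cast hsum
  have hupper : ∑ i, scale (Xi i).card ≤ 1.15 * scale m := by
    refine (sum_scale_le (by simp) _ fun i => Nat.cast_nonneg _).trans ?_
    refine mul_le_mul_of_nonneg_left ?_ (by norm_num)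
    exact Real.rpow_le_rpow (Finset.sum_nonneg fun i _ => Nat.cast_nonneg _)
      (by linarith [Nat.cast_nonneg (α := ℝ) S.card]) (by norm_num)
  have hlower := le_sum_scale hm' (Nat.cast_nonneg S.card) (fun i => ((Xi i).card : ℝ))
    (fun i => Nat.cast_nonneg _) hx hsumR
  have hHsum : ((∑ i, H i : ℕ) : ℝ) ≤ 23 * ∑ i, scale (Xi i).card := by
    push_cast
    rw [Finset.mul_sum]
    exact Finset.sum_le_sum fun i _ => hH i
  have hLsum : ((∑ i, (L i).cells.card : ℕ) : ℝ) ≤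
      1228 * ∑ i, ((Xi i).card : ℝ) - 1223 * ∑ i, scale (Xi i).card := by
    push_cast
    rw [Finset.mul_sum, Finset.mul_sum, ← Finset.sum_sub_distrib]
    exact Finset.sum_le_sum fun i _ => hL i
  obtain ⟨L', hL'⟩ := exists_compose (G := G) (X := X) (B := B) (S := S) (col := col')
    (fun i => (L i).congrCol (col' := col') fun v hv => by
      rcases hv with hv | hv
      · exact hcol'_X i v hv
      · rw [hcol'_C v (hBi i hv), hcoli i v fun h => hXiC i v h (hBi i hv)])
    (Nat.sqrt S.card + 1) ⌊23 * scale m⌋₊ (Nat.succ_pos _)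
    (Nat.le_floor (by linarith))
    -- One row for the bus and the transposed child: `1 + 28.45 * 0.773 * scale m ≤ 23 * scale m`.
    (fun i => Nat.le_floor (by
      have := hW i
      have := scale_le_of_le (Nat.cast_nonneg (Xi i).card) (hx i)
      push_cast
      linarith))
    hXB hSX hX hXi hXij hBi hadj
    (fun u hu v hv huv => hinj₁ hu hv (by rwa [hcol'_C u hu, hcol'_C v hv] at huv))
    (fun v hv => by rw [hcol'_C v hv]; exact hK₁ v hv)
    (Nat.lt_succ_sqrt S.card).le
  refine ⟨col', _, _, L', ?_, ?_, Nat.floor_le (by linarith), ?_⟩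
  · intro v hv
    rw [hcol'_not v fun i hi => hv ((hX v).2 (Or.inr ⟨i, hi⟩)), hcol₁ v fun h => hv (hSX h)]
  -- Here 28.45 = 2 + 23 * 1.15, for the square and the bus.
  · push_cast at hr hHsum ⊢
    linarith
  -- The buses leave `-(1223 - 23) = -1200` times the sum of the scales, and 1200 * 1.02 = 1224. The
  -- terms in `S.card` cancel, as 4 - 1228 + 1224 = 0, and the spare `scale m ≥ 1` absorbs the 1.
  · have h1 : (L'.cells.card : ℝ) ≤ ((4 * S.card + 1 + ∑ i, H i + ∑ i, (L i).cells.card : ℕ) : ℝ) :=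
      Nat.cast_le.2 (hL'.trans (by
        have := sqrt_add_one_mul_self_le S.card
        simp only [congrCol]
        omega))
    rw [Nat.cast_add, Nat.cast_add, Nat.cast_add, Nat.cast_mul] at h1
    have h2 : (0 : ℝ) ≤ S.card := Nat.cast_nonneg _
    norm_num at h1
    norm_num at hHsum hLsum
    linarith

end Layout

/-! ### From layouts to voxels -/

theorem voxelGrid_adj_cases {x y z x' y' z' : ℤ} (h : voxelGrid.Adj (x, y, z) (x', y', z')) :
    ((x' = x + 1 ∨ x = x' + 1) ∧ y = y' ∧ z = z') ∨ (x = x' ∧ (y' = y + 1 ∨ y = y' + 1) ∧ z = z') ∨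
      (x = x' ∧ y = y' ∧ (z' = z + 1 ∨ z = z' + 1)) := by
  have h : |x - x'| + |y - y'| + |z - z'| = 1 := h
  rcases abs_cases (x - x') with h1 | h1 <;> rcases abs_cases (y - y') with h2 | h2 <;>
    rcases abs_cases (z - z') with h3 | h3 <;> omega

theorem cellAdj_cases {x y x' y' : ℤ} (h : CellAdj (x, y) (x', y')) :
    ((x' = x + 1 ∨ x = x' + 1) ∧ y = y') ∨ (x = x' ∧ (y' = y + 1 ∨ y = y' + 1)) := by
  have h : |x - x'| + |y - y'| = 1 := h
  rcases abs_cases (x - x') with h1 | h1 <;> rcases abs_cases (y - y') with h2 | h2 <;> omega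

theorem voxelGrid_adj_x (x y z : ℤ) : voxelGrid.Adj (x, y, z) (x + 1, y, z) := by
  simp [voxelGrid]

theorem voxelGrid_adj_y (x y z : ℤ) : voxelGrid.Adj (x, y, z) (x, y + 1, z) := by
  simp [voxelGrid]

theorem voxelGrid_adj_z (x y z : ℤ) : voxelGrid.Adj (x, y, z) (x, y, z + 1) := by
  simp [voxelGrid]

/-- Two voxels are linked in `s` if there is a path of adjacent voxels of `s` between them. -/
def VoxelLinked (s : Set Voxel) : Voxel → Voxel → Prop :=
  Relation.ReflTransGen fun p q => p ∈ s ∧ q ∈ s ∧ voxelGrid.Adj p q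

namespace VoxelLinked

variable {s : Set Voxel} {p q r : Voxel}

theorem refl : VoxelLinked s p p := Relation.ReflTransGen.refl

theorem trans (h : VoxelLinked s p q) (h' : VoxelLinked s q r) : VoxelLinked s p r :=
  Relation.ReflTransGen.trans h h'

theorem single (hp : p ∈ s) (hq : q ∈ s) (h : voxelGrid.Adj p q) : VoxelLinked s p q :=
  Relation.ReflTransGen.single ⟨hp, hq, h⟩

theorem symm (h : VoxelLinked s p q) : VoxelLinked s q p := by
  induction h with
  | refl => exact refl
  | tail _ h ih => exact (single h.2.1 h.1 h.2.2.symm).trans ih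

theorem line (f : ℤ → Voxel) (n : ℕ) (hs : ∀ t : ℤ, 0 ≤ t → t ≤ n → f t ∈ s)
    (hf : ∀ t, voxelGrid.Adj (f t) (f (t + 1))) : VoxelLinked s (f 0) (f n) := by
  induction n with
  | zero => exact refl
  | succ n ih =>
    refine (ih fun t h0 h1 => hs t h0 (by push_cast; omega)).trans ?_
    rw [Nat.cast_succ]
    exact single (hs _ (by omega) (by push_cast; omega)) (hs _ (by omega) (by push_cast; omega))
      (hf _)

theorem reachable (h : VoxelLinked s p q) (hp : p ∈ s) (hq : q ∈ s) :
    (voxelGrid.induce s).Reachable ⟨p, hp⟩ ⟨q, hq⟩ := by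
  induction h with
  | refl => exact SimpleGraph.Reachable.refl _
  | tail _ h ih => exact (ih h.1).trans (SimpleGraph.Adj.reachable (by simpa using h.2.2))

end VoxelLinked

namespace Layout

variable {V : Type*} [DecidableEq V] {G : SimpleGraph V} {X B : Finset V} {K : ℕ} {col : V → ℕ}
  {W H : ℕ} (L : Layout G X B K col W H)

/-- The voxel with offset `(i, j)` at height `z` in the block of the cell `(x, y)` is in the layer
of `v` and connects the centres of the cells of `v`, or an arm from such a centre to a column. -/
def InLayer (v : V) (x y i j z : ℤ) : Prop :=
  z = 2 * col v ∧ L.Mem v (x, y) ∧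
    ((i = 0 ∧ j = 0) ∨ (j = 0 ∧ L.Mem v (x + 1, y)) ∨ (i = 0 ∧ L.Mem v (x, y + 1)) ∨
      (∃ u, L.home u = (x, y) ∧ u ∈ X ∧ (u = v ∨ G.Adj u v) ∧ ((i = 0 ∧ j ≤ 2) ∨ (i = 1 ∧ j = 2))))

/-- The voxel with offset `(i, j)` at height `z` in the block of the cell `(x, y)` is in the column
of `v`. -/
def InColumn (v : V) (x y i j z : ℤ) : Prop :=
  L.home v = (x, y) ∧ i = 2 ∧ j = 2 ∧ 0 ≤ z ∧ z < 2 * K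

/-- The voxels in the blocks of the cells of the layout. -/
noncomputable def voxels : Finset Voxel :=
  (L.cells ×ˢ Finset.Ico (0 : ℤ) 4 ×ˢ Finset.Ico (0 : ℤ) 4 ×ˢ Finset.Ico (0 : ℤ) (2 * K)).image
    fun a => (4 * a.1.1 + a.2.1, 4 * a.1.2 + a.2.2.1, a.2.2.2)

theorem card_voxels_le : L.voxels.card ≤ 32 * K * L.cells.card := by
  refine Finset.card_image_le.trans ?_
  simp only [Finset.card_product, Int.card_Ico, sub_zero]
  have : (2 * (K : ℤ)).toNat = 2 * K := by omega
  rw [this]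
  apply le_of_eq
  simp only [Int.reduceToNat]
  ring

/-- The blob of `v` in the voxel representation obtained from a layout. -/
noncomputable def blob (v : V) : Finset Voxel :=
  open Classical in
  L.voxels.filter fun p =>
    L.InLayer v (p.1 / 4) (p.2.1 / 4) (p.1 % 4) (p.2.1 % 4) p.2.2 ∨
      L.InColumn v (p.1 / 4) (p.2.1 / 4) (p.1 % 4) (p.2.1 % 4) p.2.2

variable {L} {u v : V} {x y i j z : ℤ}

theorem InLayer.mem_cells (h : L.InLayer v x y i j z) : (x, y) ∈ L.cells ∧ 0 ≤ z ∧ z < 2 * K := by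
  have := L.col_lt h.2.1
  have := h.1
  exact ⟨L.mem_cells h.2.1, by omega, by omega⟩

theorem mem_blob (hv : v ∈ X) (hi : 0 ≤ i) (hi' : i < 4) (hj : 0 ≤ j) (hj' : j < 4) :
    ((4 * x + i, 4 * y + j, z) : Voxel) ∈ L.blob v ↔
      L.InLayer v x y i j z ∨ L.InColumn v x y i j z := by
  have h1 : (4 * x + i) / 4 = x := by omega
  have h2 : (4 * y + j) / 4 = y := by omega
  have h3 : (4 * x + i) % 4 = i := by omega
  have h4 : (4 * y + j) % 4 = j := by omega
  simp only [blob, Finset.mem_filter, h1, h2, h3, h4]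
  refine ⟨And.right, fun h => ⟨?_, h⟩⟩
  have h5 : (x, y) ∈ L.cells ∧ 0 ≤ z ∧ z < 2 * K := by
    rcases h with h | h
    · exact h.mem_cells
    · exact ⟨h.1 ▸ L.mem_cells (L.mem_home hv), h.2.2.2⟩
  refine Finset.mem_image.2 ⟨((x, y), i, j, z), ?_, rfl⟩
  simp only [Finset.mem_product, Finset.mem_Ico]
  exact ⟨h5.1, ⟨hi, hi'⟩, ⟨hj, hj'⟩, h5.2⟩

theorem exists_coords {p : Voxel} (hv : v ∈ X) (hp : p ∈ L.blob v) : ∃ x y i j z : ℤ,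
    p = (4 * x + i, 4 * y + j, z) ∧ 0 ≤ i ∧ i < 4 ∧ 0 ≤ j ∧ j < 4 ∧
      (L.InLayer v x y i j z ∨ L.InColumn v x y i j z) := by
  obtain ⟨a, b, z⟩ := p
  have h : ((a, b, z) : Voxel) = (4 * (a / 4) + a % 4, 4 * (b / 4) + b % 4, z) := by
    rw [Int.mul_ediv_add_emod, Int.mul_ediv_add_emod]
  have h1 : 0 ≤ a % 4 ∧ a % 4 < 4 := by omega
  have h2 : 0 ≤ b % 4 ∧ b % 4 < 4 := by omega
  refine ⟨a / 4, b / 4, a % 4, b % 4, z, h, h1.1, h1.2, h2.1, h2.2, ?_⟩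
  rw [h] at hp
  exact (mem_blob hv h1.1 h1.2 h2.1 h2.2).1 hp

theorem InLayer.offsets (h : L.InLayer v x y i j z) : (i ≠ 0 → j ≠ 0 → i = 1 ∧ j = 2 ∧
    ∃ u, L.home u = (x, y) ∧ u ∈ X ∧ (u = v ∨ G.Adj u v)) ∧
      (i = 3 → L.Mem v (x + 1, y)) ∧ (j = 3 → L.Mem v (x, y + 1)) := by
  obtain ⟨-, -, h | h | h | ⟨u, hu, huX, huv, h⟩⟩ := h
  · exact ⟨fun h1 => absurd h.1 h1, by omega, by omega⟩
  · exact ⟨fun _ h1 => absurd h.1 h1, fun _ => h.2, by omega⟩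
  · exact ⟨fun h1 => absurd h.1 h1, by omega, fun _ => h.2⟩
  · refine ⟨fun h1 _ => ⟨by omega, by omega, u, hu, huX, huv⟩, by omega, by omega⟩

/-- Layers have even heights, so voxels at heights differing by at most 1 have the same colour. A
voxel at offset 3 lies on a segment to the next cell, which its vertex also occupies; thus `u` and
`v` share a cell. -/
theorem InLayer.eq_of_near {x' y' i' j' z' : ℤ} (h : L.InLayer u x y i j z)
    (h' : L.InLayer v x' y' i' j' z') (hz : z' ≤ z + 1) (hz' : z ≤ z' + 1)
    (hxy : (x' = x ∧ y' = y) ∨ (i = 3 ∧ x' = x + 1 ∧ y' = y) ∨ (j = 3 ∧ x' = x ∧ y' = y + 1) ∨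
      (i' = 3 ∧ x = x' + 1 ∧ y' = y) ∨ (j' = 3 ∧ x' = x ∧ y = y' + 1)) : u = v := by
  have hc : col u = col v := by
    have := h.1
    have := h'.1
    omega
  have o := h.offsets
  have o' := h'.offsets
  rcases hxy with ⟨rfl, rfl⟩ | ⟨hi, rfl, rfl⟩ | ⟨hj, rfl, rfl⟩ | ⟨hi, rfl, rfl⟩ | ⟨hj, rfl, rfl⟩
  · exact L.col_inj h.2.1 h'.2.1 hc
  · exact L.col_inj (o.2.1 hi) h'.2.1 hc
  · exact L.col_inj (o.2.2 hj) h'.2.1 hc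
  · exact L.col_inj h.2.1 (o'.2.1 hi) hc
  · exact L.col_inj h.2.1 (o'.2.2 hj) hc

theorem disjoint_blob (hu : u ∈ X) (hv : v ∈ X) (huv : u ≠ v) : Disjoint (L.blob u) (L.blob v) := by
  rw [Finset.disjoint_left]
  intro p hp hp'
  obtain ⟨x, y, i, j, z, rfl, hi, hi', hj, hj', h⟩ := exists_coords hu hp
  rw [mem_blob hv hi hi' hj hj'] at hp'
  rcases h with h | h <;> rcases hp' with h' | h'
  · exact huv (h.eq_of_near h' (by omega) (by omega) (Or.inl ⟨rfl, rfl⟩))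
  · have := h.offsets.1
    have := h'.2
    omega
  · have := h'.offsets.1
    have := h.2
    omega
  · exact huv (L.home_inj hu hv (h.1.trans h'.1.symm))

/-- Beside a column, at offset (2, 2), a layer can only contain (1, 2), the tip of an arm. Arms are
only present for the home vertex of the cell and its neighbours. -/
theorem adj_of_inLayer_of_inColumn {x' y' i' j' z' : ℤ} (hv : v ∈ X) (h : L.InLayer u x y i j z)
    (h' : L.InColumn v x' y' i' j' z') (hi : 0 ≤ i) (hi4 : i < 4) (hj : 0 ≤ j) (hj4 : j < 4)
    (huv : u ≠ v)
    (hadj : voxelGrid.Adj (4 * x + i, 4 * y + j, z) (4 * x' + i', 4 * y' + j', z')) :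
    G.Adj u v := by
  have o := h.offsets.1
  obtain ⟨h1, h2, h3, -⟩ := h'
  have hc := voxelGrid_adj_cases hadj
  obtain ⟨-, -, w, hw, hwX, hwu⟩ := o (by omega) (by omega)
  have hxy : x = x' ∧ y = y' := by omega
  obtain ⟨rfl, rfl⟩ := hxy
  obtain rfl := L.home_inj hwX hv (hw.trans h1.symm)
  exact (hwu.resolve_left huv.symm).symm

theorem adj_of_voxelGrid_adj {p q : Voxel} (hu : u ∈ X) (hv : v ∈ X) (huv : u ≠ v)
    (hp : p ∈ L.blob u) (hq : q ∈ L.blob v) (hadj : voxelGrid.Adj p q) : G.Adj u v := by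
  obtain ⟨x, y, i, j, z, rfl, hi, hi4, hj, hj4, h⟩ := exists_coords hu hp
  obtain ⟨x', y', i', j', z', rfl, hi', hi4', hj', hj4', h'⟩ := exists_coords hv hq
  rcases h with h | h <;> rcases h' with h' | h'
  · have hc := voxelGrid_adj_cases hadj
    exact absurd (h.eq_of_near h' (by omega) (by omega) (by omega)) huv
  · exact adj_of_inLayer_of_inColumn hv h h' hi hi4 hj hj4 huv hadj
  · exact (adj_of_inLayer_of_inColumn hu h' h hi' hi4' hj' hj4' huv.symm hadj.symm).symm
  · have hc := voxelGrid_adj_cases hadj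
    obtain ⟨h1, h2, h3, -⟩ := h
    obtain ⟨h1', h2', h3', -⟩ := h'
    have hxy : x = x' ∧ y = y' := by omega
    exact absurd (L.home_inj hu hv (by rw [h1, h1', hxy.1, hxy.2])) huv

/-- The tip of the arm of `v` touches the column of `u` at the height of the layer of `v`. -/
theorem exists_adj_of_mem_home (hu : u ∈ X) (hv : v ∈ X) (huv : u = v ∨ G.Adj u v)
    (hm : L.Mem v (L.home u)) : ∃ p ∈ L.blob u, ∃ q ∈ L.blob v, voxelGrid.Adj p q := by
  obtain ⟨⟨x, y⟩, hxy⟩ : ∃ p, p = L.home u := ⟨_, rfl⟩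
  rw [← hxy] at hm
  refine ⟨(4 * x + 2, 4 * y + 2, 2 * col v), ?_, (4 * x + 1, 4 * y + 2, 2 * col v), ?_, ?_⟩
  · rw [mem_blob hu] <;> try omega
    have := L.col_lt hm
    exact Or.inr ⟨hxy.symm, rfl, rfl, by omega, by omega⟩
  · rw [mem_blob hv] <;> try omega
    exact Or.inl ⟨rfl, hm, Or.inr (Or.inr (Or.inr ⟨u, hxy.symm, hu, huv, Or.inr ⟨rfl, rfl⟩⟩))⟩
  · have := voxelGrid_adj_x (4 * x + 1) (4 * y + 2) (2 * col v)
    rw [add_assoc] at this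
    exact this.symm

/-- The centre of the block of a cell in the layer of `v`. -/
def centre (col : V → ℕ) (v : V) (p : ℤ × ℤ) : Voxel := (4 * p.1, 4 * p.2, 2 * col v)

theorem centre_mem_blob {p : ℤ × ℤ} (hv : v ∈ X) (hp : L.Mem v p) : centre col v p ∈ L.blob v := by
  have := (mem_blob (L := L) (x := p.1) (y := p.2) (z := 2 * col v) hv le_rfl (by norm_num) le_rfl
    (by norm_num)).2 (Or.inl ⟨rfl, hp, Or.inl ⟨rfl, rfl⟩⟩)
  simpa [centre] using this

theorem linked_line_x (hv : v ∈ X) (hi : 0 ≤ i) (hi4 : i < 4)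
    (h : ∀ t : ℤ, 0 ≤ t → t ≤ i → L.InLayer v x y t 0 (2 * col v)) :
    VoxelLinked (L.blob v) (centre col v (x, y)) (4 * x + i, 4 * y, 2 * col v) := by
  lift i to ℕ using hi
  have := VoxelLinked.line (s := L.blob v) (fun t => (4 * x + t, 4 * y, 2 * col v)) i
    (fun t h0 h1 => by
      have := (mem_blob (L := L) (x := x) (y := y) (i := t) (z := 2 * col v) hv h0 (by omega) le_rfl
        (by norm_num)).2 (Or.inl (h t h0 h1))
      simpa using this)
    (fun t => by rw [← add_assoc]; exact voxelGrid_adj_x _ _ _)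
  simpa [centre] using this

theorem linked_line_y (hv : v ∈ X) (hj : 0 ≤ j) (hj4 : j < 4)
    (h : ∀ t : ℤ, 0 ≤ t → t ≤ j → L.InLayer v x y 0 t (2 * col v)) :
    VoxelLinked (L.blob v) (centre col v (x, y)) (4 * x, 4 * y + j, 2 * col v) := by
  lift j to ℕ using hj
  have := VoxelLinked.line (s := L.blob v) (fun t => (4 * x, 4 * y + t, 2 * col v)) j
    (fun t h0 h1 => by
      have := (mem_blob (L := L) (x := x) (y := y) (j := t) (z := 2 * col v) hv le_rfl (by norm_num)
        h0 (by omega)).2 (Or.inl (h t h0 h1))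
      simpa using this)
    (fun t => by rw [← add_assoc]; exact voxelGrid_adj_y _ _ _)
  simpa [centre] using this

theorem linked_centre_right (hv : v ∈ X) (h : L.Mem v (x, y)) (h' : L.Mem v (x + 1, y)) :
    VoxelLinked (L.blob v) (centre col v (x, y)) (centre col v (x + 1, y)) := by
  have hl : ∀ t : ℤ, L.InLayer v x y t 0 (2 * col v) := fun t =>
    ⟨rfl, h, Or.inr (Or.inl ⟨rfl, h'⟩)⟩
  refine (linked_line_x (i := 3) hv (by norm_num) (by norm_num) fun t _ _ => hl t).trans
    (VoxelLinked.single ?_ (centre_mem_blob hv h') ?_)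
  · have := (mem_blob (L := L) (i := 3) hv (by norm_num) (by norm_num) le_rfl
      (by norm_num)).2 (Or.inl (hl 3))
    simpa using this
  · have := voxelGrid_adj_x (4 * x + 3) (4 * y) (2 * col v)
    rw [show 4 * x + 3 + 1 = 4 * (x + 1) by ring] at this
    exact this

theorem linked_centre_up (hv : v ∈ X) (h : L.Mem v (x, y)) (h' : L.Mem v (x, y + 1)) :
    VoxelLinked (L.blob v) (centre col v (x, y)) (centre col v (x, y + 1)) := by
  have hl : ∀ t : ℤ, L.InLayer v x y 0 t (2 * col v) := fun t =>
    ⟨rfl, h, Or.inr (Or.inr (Or.inl ⟨rfl, h'⟩))⟩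
  refine (linked_line_y (j := 3) hv (by norm_num) (by norm_num) fun t _ _ => hl t).trans
    (VoxelLinked.single ?_ (centre_mem_blob hv h') ?_)
  · have := (mem_blob (L := L) (j := 3) hv le_rfl (by norm_num) (by norm_num)
      (by norm_num)).2 (Or.inl (hl 3))
    simpa using this
  · have := voxelGrid_adj_y (4 * x) (4 * y + 3) (2 * col v)
    rw [show 4 * y + 3 + 1 = 4 * (y + 1) by ring] at this
    exact this

theorem linked_centre {p q : ℤ × ℤ} (hv : v ∈ X) (h : Linked (L.Mem v) p q) :
    VoxelLinked (L.blob v) (centre col v p) (centre col v q) := by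
  induction h with
  | refl => exact VoxelLinked.refl
  | tail _ h ih =>
    rename_i p q _
    refine ih.trans ?_
    obtain ⟨x, y⟩ := p
    obtain ⟨x', y'⟩ := q
    obtain ⟨h1, h2, h3⟩ := h
    rcases cellAdj_cases h3 with ⟨rfl | rfl, rfl⟩ | ⟨rfl, rfl | rfl⟩
    · exact linked_centre_right hv h1 h2
    · exact (linked_centre_right hv h2 h1).symm
    · exact linked_centre_up hv h1 h2
    · exact (linked_centre_up hv h2 h1).symm

theorem linked_centre_of_inLayer (hv : v ∈ X) (hi : 0 ≤ i) (hi4 : i < 4) (hj : 0 ≤ j) (hj4 : j < 4)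
    (h : L.InLayer v x y i j z) :
    VoxelLinked (L.blob v) (centre col v (x, y)) (4 * x + i, 4 * y + j, z) := by
  obtain ⟨rfl, hm, h⟩ := h
  rcases h with ⟨rfl, rfl⟩ | ⟨rfl, h⟩ | ⟨rfl, h⟩ | ⟨u, hu, huX, huv, ⟨rfl, h⟩ | ⟨rfl, rfl⟩⟩
  · simpa [centre] using VoxelLinked.refl
  · rw [add_zero]
    exact linked_line_x hv hi hi4 fun t _ _ => ⟨rfl, hm, Or.inr (Or.inl ⟨rfl, h⟩)⟩
  · rw [add_zero]
    exact linked_line_y hv hj hj4 fun t _ _ => ⟨rfl, hm, Or.inr (Or.inr (Or.inl ⟨rfl, h⟩))⟩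
  · rw [add_zero]
    exact linked_line_y hv hj hj4 fun t _ ht =>
      ⟨rfl, hm, Or.inr (Or.inr (Or.inr ⟨u, hu, huX, huv, Or.inl ⟨rfl, by omega⟩⟩))⟩
  · have hl : ∀ t : ℤ, t ≤ 2 → L.InLayer v x y 0 t (2 * col v) := fun t ht =>
      ⟨rfl, hm, Or.inr (Or.inr (Or.inr ⟨u, hu, huX, huv, Or.inl ⟨rfl, ht⟩⟩))⟩
    refine (linked_line_y hv hj hj4 fun t _ ht => hl t ht).trans
      (VoxelLinked.single ?_ ?_ (voxelGrid_adj_x _ _ _))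
    · have := (mem_blob (L := L) hv le_rfl (by norm_num) hj hj4).2 (Or.inl (hl 2 le_rfl))
      simpa using this
    · exact (mem_blob hv hi hi4 hj hj4).2
        (Or.inl ⟨rfl, hm, Or.inr (Or.inr (Or.inr ⟨u, hu, huX, huv, Or.inr ⟨rfl, rfl⟩⟩))⟩)

theorem linked_column {z' : ℤ} (hv : v ∈ X) (h : L.InColumn v x y i j z)
    (h' : L.InColumn v x y i j z') :
    VoxelLinked (L.blob v) (4 * x + i, 4 * y + j, z) (4 * x + i, 4 * y + j, z') := by
  have key : ∀ z, L.InColumn v x y i j z →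
      VoxelLinked (L.blob v) (4 * x + i, 4 * y + j, 0) (4 * x + i, 4 * y + j, z) := by
    rintro z ⟨h1, rfl, rfl, h4, h5⟩
    lift z to ℕ using h4
    exact VoxelLinked.line (s := L.blob v) (fun t => (4 * x + 2, 4 * y + 2, t)) z
      (fun t h0 h1' => (mem_blob hv (by norm_num) (by norm_num) (by norm_num) (by norm_num)).2
        (Or.inr ⟨h1, rfl, rfl, h0, by omega⟩))
      (fun t => voxelGrid_adj_z _ _ _)
  exact (key z h).symm.trans (key z' h')

theorem connected_blob (hv : v ∈ X) : (voxelGrid.induce (L.blob v : Set Voxel)).Connected := by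
  have hm := L.mem_home hv
  have hc := centre_mem_blob hv hm
  obtain ⟨⟨x₀, y₀⟩, hxy⟩ : ∃ p, p = L.home v := ⟨_, rfl⟩
  have hcol := L.col_lt hm
  have hlink : ∀ p ∈ L.blob v, VoxelLinked (L.blob v) p (centre col v (L.home v)) := by
    intro p hp
    obtain ⟨x, y, i, j, z, rfl, hi, hi4, hj, hj4, h | h⟩ := exists_coords hv hp
    · exact (linked_centre_of_inLayer hv hi hi4 hj hj4 h).symm.trans
        (linked_centre hv (L.linked_home hv h.2.1))
    · have hcl : L.InColumn v x y i j (2 * col v) := ⟨h.1, h.2.1, h.2.2.1, by omega, by omega⟩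
      -- The arm of `v` in its own home cell joins its column to its layer.
      have har : L.InLayer v x y 1 2 (2 * col v) := ⟨rfl, h.1 ▸ hm,
        Or.inr (Or.inr (Or.inr ⟨v, h.1, hv, Or.inl rfl, Or.inr ⟨rfl, rfl⟩⟩))⟩
      refine (linked_column hv h hcl).trans (VoxelLinked.trans (VoxelLinked.symm ?_)
        (h.1 ▸ linked_centre_of_inLayer hv (by norm_num) (by norm_num) (by norm_num)
          (by norm_num) har).symm)
      refine VoxelLinked.single ((mem_blob hv (by norm_num) (by norm_num) (by norm_num)
        (by norm_num)).2 (Or.inl har)) ((mem_blob hv hi hi4 hj hj4).2 (Or.inr hcl)) ?_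
      obtain ⟨-, rfl, rfl, -⟩ := h
      have := voxelGrid_adj_x (4 * x + 1) (4 * y + 2) (2 * col v)
      rwa [add_assoc] at this
  rw [SimpleGraph.connected_iff]
  refine ⟨fun p q => ?_, ⟨⟨_, hc⟩⟩⟩
  exact ((hlink p.1 p.2).trans (hlink q.1 q.2).symm).reachable p.2 q.2

/-- The voxel representation obtained from a layout of the whole graph. -/
noncomputable def voxelRepresentation [Fintype V] (L : Layout G Finset.univ ∅ K col W H) :
    VoxelRepresentation G where
  blob := L.blob
  connected_blob := fun v => connected_blob (Finset.mem_univ v)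
  disjoint_blob := fun u v => disjoint_blob (Finset.mem_univ u) (Finset.mem_univ v)
  adj_iff := fun u v huv => by
    constructor
    · intro h
      have hu := Finset.mem_univ u
      have hv := Finset.mem_univ v
      rcases L.edge hu (Or.inl hv) h with hm | ⟨-, hm⟩
      · exact exists_adj_of_mem_home hu hv (Or.inr h) hm
      · obtain ⟨p, hp, q, hq, hpq⟩ := exists_adj_of_mem_home hv hu (Or.inr h.symm) hm
        exact ⟨q, hq, p, hp, hpq.symm⟩
    · rintro ⟨p, hp, q, hq, hpq⟩
      exact adj_of_voxelGrid_adj (Finset.mem_univ u) (Finset.mem_univ v) huv hp hq hpq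

theorem size_voxelRepresentation_le [Fintype V] (L : Layout G Finset.univ ∅ K col W H) :
    L.voxelRepresentation.size ≤ 32 * K * L.cells.card := by
  classical
  have h : (Finset.univ.biUnion L.blob).card = L.voxelRepresentation.size :=
    Finset.card_biUnion fun u hu v hv huv => disjoint_blob hu hv huv
  rw [← h]
  exact (Finset.card_le_card (Finset.biUnion_subset.2 fun v _ => Finset.filter_subset _ _)).trans
    L.card_voxels_le

end Layout

/-! ### The main theorem -/

theorem mainTheorem6 :
    ∃ C : ℕ, ∀ (V : Type*) [Fintype V] (G : SimpleGraph V),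
      ∃ R : VoxelRepresentation G,
        R.size ≤ C * (Fintype.card V * max (treewidth G) 1) := by
  classical
  -- A block has `4 * 4 * 2 * K = 32 * K` voxels, `K = 10 * (D.width + 1)` is at most `20 * max
  -- (treewidth G) 1`, and there are at most 1228 cells per vertex.
  refine ⟨32 * 20 * 1228, fun V _ G => ?_⟩
  obtain ⟨D, hD⟩ := exists_width_eq_treewidth G
  obtain ⟨col, W, H, L, -, -, -, hL⟩ := Layout.exists_layout D _ Finset.univ ∅ (fun _ => 0) rfl
    (Finset.disjoint_empty_right _) (by simp) (by simp) (by simp)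
  refine ⟨L.voxelRepresentation, L.size_voxelRepresentation_le.trans ?_⟩
  have hL' : L.cells.card ≤ 1228 * Fintype.card V := by
    have h0 : 0 ≤ scale (Finset.univ : Finset V).card := Real.rpow_nonneg (Nat.cast_nonneg _) _
    have h1 : (L.cells.card : ℝ) ≤ 1228 * (Finset.univ : Finset V).card := by linarith
    rw [Finset.card_univ] at h1
    exact_mod_cast h1
  have h2 : 10 * (D.width + 1) ≤ 20 * max (treewidth G) 1 := by omega
  calc 32 * (10 * (D.width + 1)) * L.cells.card
      ≤ 32 * (20 * max (treewidth G) 1) * (1228 * Fintype.card V) := by gcongr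
    _ = 32 * 20 * 1228 * (Fintype.card V * max (treewidth G) 1) := by ring
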